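/- Let $X\subset\mathbb R^n$ be an irreducible real algebraic curve, that is, an irreducible real algebraic set of dimension $1$. Write $\mathrm{Pol}(X)$ for the ring of polynomial functions on $X$ and $\mathcal K(X)$ for its field of fractions. Let $\pi':X'\to X$ be the normalization map of $X$: $X'\subset\mathbb R^m$ is a real algebraic set, $\pi'$ is a polynomial map such that $f\mapsto f\circ\pi'$ extends to an isomorphism $\mathcal K(X)\cong\mathcal K(X')$, and under this isomorphism $\mathrm{Pol}(X')$ is the integral closure of $\mathrm{Pol}(X)$ in $\mathcal K(X)$. Let $\mathrm{Cent}\,X$ be the central locus of $X$, i.e. the Euclidean closure in $X$ of the set of non-singular points of $X$, and let $\mathcal R^0(\mathrm{Cent}\,X)\subset\mathcal K(X)$ be the ring of continuous functions $f:\mathrm{Cent}\,X\to\mathbb R$ that are rational on $X$ (there are $p,q\in\mathrm{Pol}(X)$, $q\neq0$, with $f=p/q$ at all points of $\mathrm{Cent}\,X$ where $q\ne0$; such an $f$ is identified with $p/q\in\mathcal K(X)$). Let $\mathcal O(X')\subset\mathcal K(X')$ be the ring of regular functions on $X'$, i.e. of the fractions $p/q$ with $p,q\in\mathrm{Pol}(X')$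 and $q$ vanishing nowhere on $X'$. Then, under the identification $\mathcal K(X)\cong\mathcal K(X')$, the integral closure of $\mathcal R^0(\mathrm{Cent}\,X)$ in $\mathcal K(X)$ is equal to $\mathcal O(X')$. -/

import Mathlib

noncomputable section

namespace RealAlgGeom

/-- `X ⊆ ℝⁿ` is a real algebraic set: the set of real zeros of an ideal of polynomials. -/
def IsAlgebraicSet {n : ℕ} (X : Set (Fin n → ℝ)) : Prop :=
  ∃ I : Ideal (MvPolynomial (Fin n) ℝ), X = MvPolynomial.zeroLocus ℝ I

/-- An irreducible real algebraic set: nonempty, and not the union of two real algebraic sets that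
are both different from it. -/
structure IsIrreducibleAlgebraicSet {n : ℕ} (X : Set (Fin n → ℝ)) : Prop where
  isAlgebraicSet : IsAlgebraicSet X
  nonempty : X.Nonempty
  eq_or_eq : ∀ F G : Set (Fin n → ℝ), IsAlgebraicSet F → IsAlgebraicSet G →
    X = F ∪ G → X = F ∨ X = G

/-- The evaluation of polynomials in `n` variables as functions on `X ⊆ ℝⁿ`. -/
def polyToFun {n : ℕ} (X : Set (Fin n → ℝ)) : MvPolynomial (Fin n) ℝ →ₐ[ℝ] (X → ℝ) :=
  MvPolynomial.aeval fun (i : Fin n) (x : X) => x.1 i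

/-- The ring `Pol(X)` of polynomial functions on `X`. -/
def Pol {n : ℕ} (X : Set (Fin n → ℝ)) : Type :=
  (polyToFun X).range

instance Pol.instCommRing {n : ℕ} (X : Set (Fin n → ℝ)) : CommRing (Pol X) :=
  inferInstanceAs (CommRing (polyToFun X).range)

instance Pol.instAlgebra {n : ℕ} (X : Set (Fin n → ℝ)) : Algebra ℝ (Pol X) :=
  inferInstanceAs (Algebra ℝ (polyToFun X).range)

/-- The inclusion of `Pol(X)` in the ring of all real functions on `X`. -/
def Pol.toFun {n : ℕ} (X : Set (Fin n → ℝ)) : Pol X →ₐ[ℝ] (X → ℝ) :=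
  (polyToFun X).range.val

instance Pol.instCoeFun {n : ℕ} (X : Set (Fin n → ℝ)) : CoeFun (Pol X) fun _ => X → ℝ :=
  ⟨Pol.toFun X⟩

/-- The total ring of fractions `K(X)` of `Pol(X)`; the field of rational functions when `X` is
irreducible. -/
def RatFun {n : ℕ} (X : Set (Fin n → ℝ)) : Type :=
  FractionRing (Pol X)

instance RatFun.instCommRing {n : ℕ} (X : Set (Fin n → ℝ)) : CommRing (RatFun X) :=
  inferInstanceAs (CommRing (FractionRing (Pol X)))

instance RatFun.instAlgebra {n : ℕ} (X : Set (Fin n → ℝ)) : Algebra ℝ (RatFun X) :=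
  inferInstanceAs (Algebra ℝ (FractionRing (Pol X)))

instance RatFun.instAlgebraPol {n : ℕ} (X : Set (Fin n → ℝ)) : Algebra (Pol X) (RatFun X) :=
  inferInstanceAs (Algebra (Pol X) (FractionRing (Pol X)))

instance RatFun.instIsScalarTower {n : ℕ} (X : Set (Fin n → ℝ)) :
    IsScalarTower ℝ (Pol X) (RatFun X) :=
  inferInstanceAs (IsScalarTower ℝ (Pol X) (FractionRing (Pol X)))

instance RatFun.instIsFractionRing {n : ℕ} (X : Set (Fin n → ℝ)) :
    IsFractionRing (Pol X) (RatFun X) :=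
  inferInstanceAs (IsFractionRing (Pol X) (FractionRing (Pol X)))

/-- The dimension of a real algebraic set: the Krull dimension of `Pol(X)`. -/
def dim {n : ℕ} (X : Set (Fin n → ℝ)) : WithBot ℕ∞ :=
  ringKrullDim (Pol X)

/-- The evaluation `Pol(X) → ℝ` at a point `x` of `X`. -/
def evalAt {n : ℕ} {X : Set (Fin n → ℝ)} (x : X) : Pol X →ₐ[ℝ] ℝ :=
  (Pi.evalAlgHom ℝ (fun _ : X => ℝ) x).comp (Pol.toFun X)

/-- The (maximal) ideal `𝔪ₓ` of `Pol(X)` of the polynomial functions that vanish at `x`. -/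
def idealAt {n : ℕ} {X : Set (Fin n → ℝ)} (x : X) : Ideal (Pol X) :=
  RingHom.ker (evalAt x)

instance idealAt_isPrime {n : ℕ} {X : Set (Fin n → ℝ)} (x : X) : (idealAt x).IsPrime :=
  RingHom.ker_isPrime (evalAt x)

/-- `x` is a non-singular point of the irreducible algebraic set `X`: the local ring of `X` at `x`
is regular. -/
def IsNonsingularPoint {n : ℕ} {X : Set (Fin n → ℝ)} (x : X) : Prop :=
  IsRegularLocalRing (Localization.AtPrime (idealAt x))

/-- The central locus of `X`: the Euclidean closure in `X` of the set of non-singular points. -/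
def Cent {n : ℕ} (X : Set (Fin n → ℝ)) : Set X :=
  closure {x : X | IsNonsingularPoint x}

/-- The ring `𝒪(X)` of regular functions on `X`, as the subring of `K(X)` of all fractions `p / q`
of polynomial functions whose denominator `q` vanishes nowhere on `X`
(such a `q` is not a zero divisor). -/
def Reg {n : ℕ} (X : Set (Fin n → ℝ)) : Subalgebra ℝ (RatFun X) where
  carrier := {h | ∃ p q : Pol X, (∀ x : X, q x ≠ 0) ∧
    h * algebraMap (Pol X) (RatFun X) q = algebraMap (Pol X) (RatFun X) p}
  mul_mem' := by
    rintro a b ⟨p, q, hq, h⟩ ⟨p', q', hq', h'⟩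
    refine ⟨p * p', q * q', fun x => by simpa using ⟨hq x, hq' x⟩, ?_⟩
    rw [map_mul, map_mul, ← h, ← h']; ring
  add_mem' := by
    rintro a b ⟨p, q, hq, h⟩ ⟨p', q', hq', h'⟩
    refine ⟨p * q' + p' * q, q * q', fun x => by simpa using ⟨hq x, hq' x⟩, ?_⟩
    rw [map_add, map_mul, map_mul, map_mul, ← h, ← h']; ring
  algebraMap_mem' := by
    intro r
    refine ⟨algebraMap ℝ (Pol X) r, 1, fun x => by simp, ?_⟩
    rw [map_one, mul_one, ← IsScalarTower.algebraMap_apply]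

/-- The function `f` on `Cent X` is rational on `X`, with class `h` in `K(X)`: there is a fraction
`p / q` representing `h`, with `{q ≠ 0}` Zariski dense in `X` (that is, `q` not a zero divisor),
such that `f = p / q` at all points of `Cent X` where `q` does not vanish. -/
def HasRationalClass {n : ℕ} {X : Set (Fin n → ℝ)} (f : Cent X → ℝ) (h : RatFun X) : Prop :=
  ∃ p q : Pol X, q ∈ nonZeroDivisors (Pol X) ∧
    h * algebraMap (Pol X) (RatFun X) q = algebraMap (Pol X) (RatFun X) p ∧
    ∀ x : Cent X, q x.1 ≠ 0 → f x = p x.1 / q x.1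

/-- The ring of continuous rational functions on `Cent X`, as a subring of `K(X)`: the classes in
`K(X)` of the continuous functions on `Cent X` that are rational on `X`. (For irreducible `X`, such
a function and its class determine each other.) -/
def ContRat {n : ℕ} (X : Set (Fin n → ℝ)) : Subalgebra ℝ (RatFun X) where
  carrier := {h | ∃ f : C(Cent X, ℝ), HasRationalClass f h}
  mul_mem' := by
    rintro a b ⟨f, p, q, hq, h, hf⟩ ⟨f', p', q', hq', h', hf'⟩
    refine ⟨f * f', p * p', q * q', mul_mem hq hq', ?_, ?_⟩
    · rw [map_mul, map_mul, ← h, ← h']; ring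
    · intro x hx
      have h1 : q x.1 ≠ 0 := fun h0 => hx (by simp [h0])
      have h2 : q' x.1 ≠ 0 := fun h0 => hx (by simp [h0])
      simp [hf x h1, hf' x h2, div_mul_div_comm]
  add_mem' := by
    rintro a b ⟨f, p, q, hq, h, hf⟩ ⟨f', p', q', hq', h', hf'⟩
    refine ⟨f + f', p * q' + q * p', q * q', mul_mem hq hq', ?_, ?_⟩
    · rw [map_add, map_mul, map_mul, map_mul, ← h, ← h']; ring
    · intro x hx
      have h1 : q x.1 ≠ 0 := fun h0 => hx (by simp [h0])
      have h2 : q' x.1 ≠ 0 := fun h0 => hx (by simp [h0])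
      simp [hf x h1, hf' x h2, div_add_div _ _ h1 h2]
  algebraMap_mem' := by
    intro r
    refine ⟨ContinuousMap.const _ r, algebraMap ℝ (Pol X) r, 1, one_mem _, ?_, ?_⟩
    · rw [map_one, mul_one, ← IsScalarTower.algebraMap_apply]
    · intro x _
      simp

/-- A polynomial map: its coordinates are polynomial functions. -/
def IsPolynomialMap {n m : ℕ} {X : Set (Fin n → ℝ)} {Y : Set (Fin m → ℝ)} (π : Y → X) : Prop :=
  ∀ i : Fin n, ∃ g : Pol Y, ∀ y : Y, (π y).1 i = g y

/-- `π : X' → X` is the normalization map of `X`, and `e : K(X) ≃ K(X')` is the identification that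
it induces: `π` is a polynomial map, `e` extends `f ↦ f ∘ π` from `Pol(X)` to `K(X)`, and under `e`
the ring `Pol(X')` is the integral closure of `Pol(X)` in `K(X)`.
(The isomorphism `e` is determined by `π`.) -/
structure IsNormalizationMap {n m : ℕ} {X : Set (Fin n → ℝ)} {X' : Set (Fin m → ℝ)}
    (π : X' → X) (e : RatFun X ≃ₐ[ℝ] RatFun X') : Prop where
  isPolynomialMap : IsPolynomialMap π
  map_algebraMap : ∀ (f : Pol X) (g : Pol X'), (∀ y : X', g y = f (π y)) →
    e (algebraMap (Pol X) (RatFun X) f) = algebraMap (Pol X') (RatFun X') g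
  isIntegral_iff : ∀ h : RatFun X, IsIntegral (Pol X) h ↔
    ∃ g : Pol X', algebraMap (Pol X') (RatFun X') g = e h

end RealAlgGeom

end

/-! Integral closedness and Krull dimension one make `Pol X'` a Dedekind domain. The local ring at
each point of `X'` is therefore a discrete valuation ring, and `Reg X'` is the intersection of these
local rings inside `RatFun X'`, because a sum of squares of denominators vanishes only at their
common zeros (`mem_Reg_of_forall`).

Continuous rational functions have no poles on `X'`. If `e h` had a pole at `y`, then `h ∘ π` would
be unbounded near `y`. But `h` extends continuously to `X` by Tietze, and `y` is not isolated in
`X'` (`IsValuativeAt.nhdsNE_neBot`): at a point with a valuative local ring, the inverse function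
theorem produces nearby points of the real set. Hence `ContRat X` maps into every local ring of
`X'`. Valuation rings are integrally closed, so elements integral over `ContRat X` follow.

Conversely, `Pol X'` is finite over `Pol X`, so there is a nonzero conductor element `d`. The map
`π` is proper (`exists_norm_le`) and surjective onto the locus `d ≠ 0`, so `d * c` is continuous on
`X` for every regular `c` on `X'`: near a zero of `d` it is bounded by a multiple of `|d|`
(`mul_mem_ContRat_of_conductor`). Modulo `d`, regular functions are integral over `ℝ`, because `Pol
X'` modulo `d` is finite-dimensional (`exists_monic_aeval_eq_mul`). Some monic real polynomial in
`k` is therefore `d` times a regular function, hence in `ContRat X`, and `k` is integral. -/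

namespace RealAlgGeom

open MvPolynomial Filter Topology

/-! ### Polynomial functions, points and regular functions -/

section Basic

variable {n : ℕ} {X : Set (Fin n → ℝ)}

/-- The restriction of polynomials to polynomial functions on `X`. -/
noncomputable def Pol.restrict (X : Set (Fin n → ℝ)) : MvPolynomial (Fin n) ℝ →ₐ[ℝ] Pol X :=
  (polyToFun X).rangeRestrict

theorem Pol.restrict_surjective (X : Set (Fin n → ℝ)) : Function.Surjective (Pol.restrict X) :=
  (polyToFun X).rangeRestrict_surjective

@[simp]
theorem Pol.restrict_apply (F : MvPolynomial (Fin n) ℝ) (x : X) :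
    Pol.restrict X F x = eval x.1 F := by
  change polyToFun X F x = _
  induction F using MvPolynomial.induction_on with
  | C a => simp [polyToFun]
  | add p q hp hq => simp [hp, hq]
  | mul_X p i hp =>
    rw [map_mul, Pi.mul_apply, hp]
    simp [polyToFun]

@[ext]
theorem Pol.ext {p q : Pol X} (h : ∀ x : X, p x = q x) : p = q :=
  Subtype.ext (funext h)

@[simp]
theorem evalAt_apply (x : X) (p : Pol X) : evalAt x p = p x := rfl

theorem mem_idealAt {x : X} {p : Pol X} : p ∈ idealAt x ↔ p x = 0 := Iff.rfl

theorem Pol.continuous (p : Pol X) : Continuous (Pol.toFun X p) := by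
  obtain ⟨F, rfl⟩ := Pol.restrict_surjective X p
  have : Pol.toFun X (Pol.restrict X F) = fun x : X => eval x.1 F :=
    funext fun x => Pol.restrict_apply F x
  rw [this]
  exact (MvPolynomial.continuous_eval F).comp continuous_subtype_val

instance Pol.instFiniteType : Algebra.FiniteType ℝ (Pol X) :=
  Algebra.FiniteType.of_surjective (Pol.restrict X) (Pol.restrict_surjective X)

instance Pol.instIsNoetherianRing : IsNoetherianRing (Pol X) :=
  isNoetherianRing_of_surjective _ _ (Pol.restrict X).toRingHom (Pol.restrict_surjective X)

theorem IsAlgebraicSet.isClosed (hX : IsAlgebraicSet X) : IsClosed X := by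
  obtain ⟨I, rfl⟩ := hX
  have : zeroLocus ℝ I = ⋂ F ∈ I, {x : Fin n → ℝ | eval x F = 0} := by
    ext x; simp [MvPolynomial.mem_zeroLocus_iff, aeval_eq_eval]
  rw [this]
  exact isClosed_biInter fun F _ => isClosed_eq (MvPolynomial.continuous_eval F) continuous_const

/-- Membership in an algebraic set is tested by the polynomials that vanish on the set. -/
theorem IsAlgebraicSet.mem_of_forall (hX : IsAlgebraicSet X) {x : Fin n → ℝ}
    (h : ∀ F : MvPolynomial (Fin n) ℝ, Pol.restrict X F = 0 → eval x F = 0) : x ∈ X := by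
  obtain ⟨I, rfl⟩ := hX
  rw [MvPolynomial.mem_zeroLocus_iff]
  intro F hF
  rw [aeval_eq_eval]
  refine h F (Pol.ext fun y => ?_)
  have := (MvPolynomial.mem_zeroLocus_iff.1 y.2) F hF
  rw [Pol.restrict_apply, map_zero, ← aeval_eq_eval]
  exact this

/-- The zero set in `X` of a polynomial is algebraic. -/
theorem IsAlgebraicSet.inter_zeros (hX : IsAlgebraicSet X) (F : MvPolynomial (Fin n) ℝ) :
    IsAlgebraicSet {x | x ∈ X ∧ eval x F = 0} := by
  obtain ⟨I, rfl⟩ := hX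
  refine ⟨I ⊔ Ideal.span {F}, ?_⟩
  ext x
  simp only [Set.mem_ofPred_eq, MvPolynomial.mem_zeroLocus_iff, aeval_eq_eval]
  constructor
  · rintro ⟨h1, h2⟩
    have : I ⊔ Ideal.span {F} ≤ RingHom.ker (eval x) :=
      sup_le (fun p hp => h1 p hp) ((Ideal.span_singleton_le_iff_mem _).2 h2)
    exact fun p hp => this hp
  · exact fun h => ⟨fun p hp => h p (Ideal.mem_sup_left hp),
      h F (Ideal.mem_sup_right (Ideal.mem_span_singleton_self F))⟩

/-- If a product of two polynomials vanishes on `X`, then `X` is the union of their zero sets, and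
irreducibility makes one of these all of `X`. -/
theorem IsIrreducibleAlgebraicSet.isDomain (hX : IsIrreducibleAlgebraicSet X) :
    IsDomain (Pol X) := by
  have : Nontrivial (Pol X) := by
    obtain ⟨x, hx⟩ := hX.nonempty
    refine ⟨0, 1, fun h => ?_⟩
    have := congrArg (evalAt (⟨x, hx⟩ : X)) h
    simp only [map_zero, map_one] at this
    exact zero_ne_one this
  have : NoZeroDivisors (Pol X) := by
    refine ⟨fun {a b} hab => ?_⟩
    obtain ⟨F, rfl⟩ := Pol.restrict_surjective X a
    obtain ⟨G, rfl⟩ := Pol.restrict_surjective X b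
    have key : X = {x | x ∈ X ∧ eval x F = 0} ∪ {x | x ∈ X ∧ eval x G = 0} := by
      ext x
      refine ⟨fun hx => ?_, by rintro (h | h) <;> exact h.1⟩
      have h := congrArg (evalAt (⟨x, hx⟩ : X)) hab
      simp only [map_mul, map_zero, evalAt_apply, Pol.restrict_apply, mul_eq_zero] at h
      exact h.imp (fun h => ⟨hx, h⟩) (fun h => ⟨hx, h⟩)
    have aux : ∀ H : MvPolynomial (Fin n) ℝ, X = {x | x ∈ X ∧ eval x H = 0} →
        Pol.restrict X H = 0 := by
      intro H hH
      refine Pol.ext fun x => ?_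
      have h : x.1 ∈ {x | x ∈ X ∧ eval x H = 0} := hH ▸ x.2
      simpa using h.2
    exact (hX.eq_or_eq _ _ (hX.isAlgebraicSet.inter_zeros F) (hX.isAlgebraicSet.inter_zeros G)
      key).imp (aux F) (aux G)
  exact NoZeroDivisors.to_isDomain _

/-- Every real character of `Pol(X)` is the evaluation at a point of the algebraic set `X`. -/
theorem IsAlgebraicSet.exists_eq_evalAt (hX : IsAlgebraicSet X) (ψ : Pol X →ₐ[ℝ] ℝ) :
    ∃ x : X, ψ = evalAt x := by
  set v : Fin n → ℝ := fun i => ψ (Pol.restrict X (MvPolynomial.X i)) with hv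
  have key : ∀ F, ψ (Pol.restrict X F) = eval v F := by
    intro F
    have : ψ.comp (Pol.restrict X) = aeval v := MvPolynomial.algHom_ext fun i => by simp [hv]
    rw [← aeval_eq_eval]
    exact DFunLike.congr_fun this F
  have hmem : v ∈ X := hX.mem_of_forall fun F hF => by rw [← key, hF, map_zero]
  refine ⟨⟨v, hmem⟩, AlgHom.ext fun p => ?_⟩
  obtain ⟨F, rfl⟩ := Pol.restrict_surjective X p
  rw [key, evalAt_apply, Pol.restrict_apply]

theorem idealAt_injective : Function.Injective (idealAt : X → Ideal (Pol X)) := by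
  intro x y h
  refine Subtype.ext (funext fun i => ?_)
  have : Pol.restrict X (MvPolynomial.X i - C (x.1 i)) ∈ idealAt y := by
    rw [← h, mem_idealAt, Pol.restrict_apply]; simp
  rw [mem_idealAt, Pol.restrict_apply] at this
  simp only [map_sub, eval_X, eval_C] at this
  linarith

/-- On a curve, a nonzero polynomial function has finitely many zeros. -/
theorem Pol.finite_zeros [IsDomain (Pol X)] [Ring.DimensionLEOne (Pol X)] {q : Pol X}
    (hq : q ≠ 0) : {x : X | q x = 0}.Finite := by
  refine Set.Finite.of_finite_image
    (f := idealAt) ?_ (idealAt_injective.injOn)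
  -- In dimension one, every prime containing `q ≠ 0` is minimal over `(q)`, and a Noetherian ring
  -- has finitely many of these.
  refine (Ideal.finite_minimalPrimes_of_isNoetherianRing (Pol X) (Ideal.span {q})).subset ?_
  rintro _ ⟨x, hx, rfl⟩
  refine ⟨⟨inferInstance, (Ideal.span_singleton_le_iff_mem _).2 hx⟩, ?_⟩
  rintro P ⟨hP, hqP⟩ hle
  have hP0 : P ≠ ⊥ := fun h => hq (by simpa [h] using hqP)
  have := Ring.DimensionLEOne.maximalOfPrime hP0 hP
  exact (this.eq_of_le (Ideal.IsPrime.ne_top inferInstance) hle).ge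

/-- If `h` has a denominator that does not vanish at `x`, for every `x ∈ X`, then `h` is regular. -/
theorem mem_Reg_of_forall {h : RatFun X}
    (H : ∀ x : X, ∃ p q : Pol X, q x ≠ 0 ∧
      h * algebraMap (Pol X) (RatFun X) q = algebraMap (Pol X) (RatFun X) p) :
    h ∈ Reg X := by
  let D : Ideal (Pol X) :=
    { carrier := {q | ∃ p, h * algebraMap (Pol X) (RatFun X) q = algebraMap (Pol X) (RatFun X) p}
      add_mem' := by
        rintro a b ⟨p, hp⟩ ⟨p', hp'⟩
        exact ⟨p + p', by rw [map_add, map_add, mul_add, hp, hp']⟩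
      zero_mem' := ⟨0, by simp⟩
      smul_mem' := by
        rintro c a ⟨p, hp⟩
        exact ⟨c * p, by rw [smul_eq_mul, map_mul, map_mul, ← hp]; ring⟩ }
  obtain ⟨s, hs⟩ := (isNoetherianRing_iff_ideal_fg (Pol X)).1 inferInstance D
  -- `D` is the ideal of denominators of `h`. Over `ℝ` the sum of the squares of its generators
  -- vanishes only where all of `D` does, which by `H` is nowhere.
  have hQ : ∑ q ∈ s, q * q ∈ D :=
    D.sum_mem fun q hq => D.mul_mem_left _ (hs ▸ Ideal.subset_span hq)
  obtain ⟨p, hp⟩ := hQ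
  refine ⟨p, _, fun x hx => ?_, hp⟩
  have h0 : ∀ q ∈ s, q x = 0 := by
    intro q hq
    have : ∑ q ∈ s, q x * q x = 0 := by
      rw [← hx, ← evalAt_apply, map_sum]; simp
    exact mul_self_eq_zero.1 ((Finset.sum_eq_zero_iff_of_nonneg
      fun q _ => mul_self_nonneg (q x)).1 this q hq)
  have hle : D ≤ idealAt x := hs ▸ Ideal.span_le.2 fun q hq => h0 q hq
  obtain ⟨p', q', hq', hpq⟩ := H x
  exact hq' (hle ⟨p', hpq⟩)

end Basic

/-! ### Valuative points are non-singular and not isolated -/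

section Nonisolated

variable {n : ℕ} {X : Set (Fin n → ℝ)}

/-- The local ring of `X` at `x` is totally ordered by divisibility. -/
def IsValuativeAt (x : X) : Prop :=
  ∀ a b : Pol X, ∃ s c : Pol X, s x ≠ 0 ∧ (s * a = c * b ∨ s * b = c * a)

theorem isValuativeAt_of_valuationRing [IsDomain (Pol X)] (x : X)
    [ValuationRing (Localization.AtPrime (idealAt x))] : IsValuativeAt x := by
  have key : ∀ a b : Pol X,
      algebraMap (Pol X) (Localization.AtPrime (idealAt x)) b ∣
        algebraMap (Pol X) (Localization.AtPrime (idealAt x)) a →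
      ∃ s c : Pol X, s x ≠ 0 ∧ s * a = c * b := by
    rintro a b ⟨t, ht⟩
    obtain ⟨⟨c, s⟩, hcs⟩ := IsLocalization.surj (idealAt x).primeCompl t
    refine ⟨s, c, s.2, ?_⟩
    apply IsLocalization.injective (Localization.AtPrime (idealAt x))
      (idealAt x).primeCompl_le_nonZeroDivisors
    rw [map_mul, map_mul, ht, ← hcs]
    ring
  intro a b
  rcases ValuationRing.dvd_total (algebraMap (Pol X) (Localization.AtPrime (idealAt x)) b)
    (algebraMap (Pol X) (Localization.AtPrime (idealAt x)) a) with h | h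
  · obtain ⟨s, c, hs, h⟩ := key a b h
    exact ⟨s, c, hs, Or.inl h⟩
  · obtain ⟨s, c, hs, h⟩ := key b a h
    exact ⟨s, c, hs, Or.inr h⟩

/-- A Noetherian valuation ring is a principal ideal ring, and a local principal ideal domain is
regular. -/
theorem IsValuativeAt.isNonsingularPoint [IsDomain (Pol X)] {x : X} (hx : IsValuativeAt x) :
    IsNonsingularPoint x := by
  let L := Localization.AtPrime (idealAt x)
  have hdom : IsDomain L :=
    IsLocalization.isDomain_of_le_nonZeroDivisors _ (idealAt x).primeCompl_le_nonZeroDivisors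
  have hnoeth : IsNoetherianRing L :=
    IsLocalization.isNoetherianRing (idealAt x).primeCompl L inferInstance
  have hunit : ∀ s : Pol X, s x ≠ 0 → IsUnit (algebraMap (Pol X) L s) := fun s hs =>
    IsLocalization.map_units L (⟨s, hs⟩ : (idealAt x).primeCompl)
  have key : ∀ a b s c : Pol X, s x ≠ 0 → s * a = c * b →
      algebraMap (Pol X) L b ∣ algebraMap (Pol X) L a := by
    intro a b s c hs h
    rw [← (hunit s hs).dvd_mul_left, ← map_mul, h, map_mul]
    exact Dvd.intro_left _ rfl
  have hval : ValuationRing L := by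
    refine ValuationRing.iff_dvd_total.2 ⟨fun f g => ?_⟩
    obtain ⟨⟨a, t⟩, hf⟩ := IsLocalization.surj (idealAt x).primeCompl f
    obtain ⟨⟨b, w⟩, hg⟩ := IsLocalization.surj (idealAt x).primeCompl g
    have ht := hunit t t.2
    have hw := hunit w w.2
    rw [← ht.dvd_mul_right (a := g), ← hw.dvd_mul_right (a := f),
      ← ht.mul_right_dvd (a := f), ← hw.mul_right_dvd (a := g)]
    simp only at hf hg
    rw [hf, hg]
    obtain ⟨s, c, hs, h | h⟩ := hx a b
    · exact Or.inr (key a b s c hs h)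
    · exact Or.inl (key b a s c hs h)
  have hpid : IsPrincipalIdealRing L := (IsBezout.TFAE (R := L)).out 0 1 |>.1 hnoeth
  change IsRegularLocalRing L
  infer_instance

/-- Among finitely many functions, one divides the others locally at `x`. -/
theorem IsValuativeAt.exists_dvd {x : X} (hx : IsValuativeAt x) {ι : Type*} (s : Finset ι)
    (hs : s.Nonempty) (f : ι → Pol X) :
    ∃ i ∈ s, ∀ j ∈ s, ∃ u c : Pol X, u x ≠ 0 ∧ u * f j = c * f i := by
  classical
  induction hs using Finset.Nonempty.cons_induction with
  | singleton a =>
    refine ⟨a, by simp, fun j hj => ⟨1, 1, by simp, ?_⟩⟩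
    rw [Finset.mem_singleton.1 hj]
  | cons a s ha hs ih =>
    obtain ⟨i, hi, h⟩ := ih
    obtain ⟨u, c, hu, h1 | h1⟩ := hx (f a) (f i)
    · refine ⟨i, by simp [hi], fun j hj => ?_⟩
      rcases Finset.mem_cons.1 hj with rfl | hj
      · exact ⟨u, c, hu, h1⟩
      · exact h j hj
    · refine ⟨a, by simp, fun j hj => ?_⟩
      rcases Finset.mem_cons.1 hj with rfl | hj
      · exact ⟨1, 1, by simp, rfl⟩
      · obtain ⟨v, d, hv, h2⟩ := h j hj
        refine ⟨u * v, d * c, by simp [hu, hv], ?_⟩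
        linear_combination u * h2 + d * h1

theorem eval_hasStrictFDerivAt (F : MvPolynomial (Fin n) ℝ) (x : Fin n → ℝ) :
    ∃ L : (Fin n → ℝ) →L[ℝ] ℝ, HasStrictFDerivAt (fun y => eval y F) L x :=
  ⟨_, ((AnalyticOnNhd.eval_mvPolynomial F) x trivial).hasStrictFDerivAt⟩

/-- The maximal ideal of a point is generated by the translated coordinates. -/
theorem sub_eval_mem_span (x : Fin n → ℝ) (F : MvPolynomial (Fin n) ℝ) :
    F - C (eval x F) ∈ Ideal.span (Set.range fun i => MvPolynomial.X i - C (x i)) := by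
  induction F using MvPolynomial.induction_on with
  | C a => simp
  | add p q hp hq =>
    have := Ideal.add_mem _ hp hq
    convert this using 1
    simp only [map_add]; ring
  | mul_X p i hp =>
    have h1 := Ideal.mul_mem_right (MvPolynomial.X i) _ hp
    have h2 : MvPolynomial.X i - C (x i) ∈
        Ideal.span (Set.range fun i => (MvPolynomial.X i - C (x i) : MvPolynomial (Fin n) ℝ)) :=
      Ideal.subset_span ⟨i, rfl⟩
    have := Ideal.add_mem _ h1 (Ideal.mul_mem_left _ (C (eval x p)) h2)
    convert this using 1
    simp only [map_mul, eval_X]; ring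

/-- The inverse function theorem for a triangular system of equations: in each neighbourhood of `x`
the equations `sᵢ(y) (yᵢ - xᵢ) = aᵢ(y) (yₖ - xₖ)` have a solution `y` with `yₖ ≠ xₖ`. -/
theorem exists_solution_near (x : Fin n → ℝ) (k : Fin n) (s a : Fin n → MvPolynomial (Fin n) ℝ)
    (hs : ∀ i, eval x (s i) ≠ 0) {U : Set (Fin n → ℝ)} (hU : U ∈ 𝓝 x) :
    ∃ y ∈ U, y k ≠ x k ∧
      ∀ i ≠ k, eval y (s i) * (y i - x i) = eval y (a i) * (y k - x k) := by
  classical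
  let Φ : (Fin n → ℝ) → Fin n → ℝ := fun y i =>
    if i = k then y k - x k else eval y (s i) * (y i - x i) - eval y (a i) * (y k - x k)
  let pr : Fin n → (Fin n → ℝ) →L[ℝ] ℝ := fun i => ContinuousLinearMap.proj i
  let L : Fin n → (Fin n → ℝ) →L[ℝ] ℝ := fun i =>
    if i = k then pr k else eval x (s i) • pr i - eval x (a i) • pr k
  -- The derivatives of `s i` and `a i` do not enter `L`: they are multiplied by `y i - x i` and `y
  -- k - x k`, which vanish at `x`.
  have hpr : ∀ i, HasStrictFDerivAt (fun y : Fin n → ℝ => y i - x i) (pr i) x := fun i =>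
    (pr i).hasStrictFDerivAt.sub_const (x i)
  have hΦ : HasStrictFDerivAt Φ (ContinuousLinearMap.pi L) x := by
    rw [hasStrictFDerivAt_pi]
    intro i
    by_cases hi : i = k
    · simp only [L, hi, if_true]
      exact hpr k
    · simp only [L, hi, if_false]
      obtain ⟨S', hS'⟩ := eval_hasStrictFDerivAt (s i) x
      obtain ⟨A', hA'⟩ := eval_hasStrictFDerivAt (a i) x
      convert (hS'.mul (hpr i)).sub (hA'.mul (hpr k)) using 1
      · rfl
      · simp
  have hrange : (ContinuousLinearMap.pi L : (Fin n → ℝ) →L[ℝ] Fin n → ℝ).range = ⊤ := by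
    rw [LinearMap.range_eq_top]
    intro v
    refine ⟨fun i => if i = k then v k else (v i + eval x (a i) * v k) / eval x (s i), ?_⟩
    ext i
    by_cases hi : i = k
    · subst hi; simp [L, pr]
    · have := hs i
      simp [L, pr, hi]
      field_simp
      ring
  have hmap := hΦ.map_nhds_eq_of_surj hrange
  have hx0 : Φ x = 0 := by
    ext i; by_cases hi : i = k <;> simp [Φ, hi]
  have him : Φ '' U ∈ 𝓝 (0 : Fin n → ℝ) := by
    rw [← hx0, ← hmap]; exact image_mem_map hU
  -- A preimage under `Φ` of `t` times the `k`-th basis vector, with `t ≠ 0` small, is the required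
  -- solution, with `y k - x k = t`.
  have hcont : Tendsto (fun t : ℝ => (Pi.single k t : Fin n → ℝ)) (𝓝[≠] 0) (𝓝 0) := by
    have : Continuous fun t : ℝ => (Pi.single k t : Fin n → ℝ) := continuous_pi fun i => by
      by_cases hi : i = k
      · subst hi; simpa using continuous_id'
      · simpa [Pi.single_eq_of_ne hi] using continuous_const
    have h := this.tendsto 0
    simp only [Pi.single_zero] at h
    exact h.mono_left nhdsWithin_le_nhds
  obtain ⟨t, ht, ht0⟩ := ((hcont.eventually him).and self_mem_nhdsWithin).exists
  obtain ⟨y, hy, hyt⟩ := ht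
  refine ⟨y, hy, ?_, fun i hi => ?_⟩
  · have := congrFun hyt k
    simp only [Φ, if_true, Pi.single_eq_same] at this
    intro h
    apply ht0
    rw [← this, h]; simp
  · have := congrFun hyt i
    simp only [Φ, hi, if_false, Pi.single_eq_of_ne hi] at this
    linarith

/-- If all coordinates are constant on `X`, then `Pol(X)` is a field. -/
theorem exists_coord_ne_zero [IsDomain (Pol X)] (hfield : ¬ IsField (Pol X)) (x : X) :
    ∃ i, Pol.restrict X (MvPolynomial.X i - C (x.1 i)) ≠ 0 := by
  by_contra! h
  apply hfield
  refine ⟨⟨0, 1, zero_ne_one⟩, mul_comm, fun {p} hp => ?_⟩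
  obtain ⟨F, rfl⟩ := Pol.restrict_surjective X p
  have hle : Ideal.span (Set.range fun i => (MvPolynomial.X i - C (x.1 i) :
      MvPolynomial (Fin n) ℝ)) ≤ RingHom.ker (Pol.restrict X) := by
    rw [Ideal.span_le]
    rintro _ ⟨i, rfl⟩
    exact h i
  have hF : Pol.restrict X F = Pol.restrict X (C (eval x.1 F)) := by
    have := hle (sub_eval_mem_span x.1 F)
    rwa [RingHom.mem_ker, map_sub, sub_eq_zero] at this
  have h0 : eval x.1 F ≠ 0 := fun h0 => hp (by rw [hF, h0]; simp)
  refine ⟨Pol.restrict X (C (eval x.1 F)⁻¹), ?_⟩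
  rw [hF, ← map_mul, ← C_mul, mul_inv_cancel₀ h0]
  simp

/-- A real linear system `S g = t B g` with `|t| ‖B‖ < |S|` has only the trivial solution. -/
theorem eq_zero_of_mul_eq_sum {ι : Type*} [Fintype ι] {S t : ℝ} {b : ι → ι → ℝ} {g : ι → ℝ}
    (h : ∀ j, S * g j = t * ∑ l, b j l * g l) (hlt : ∀ j, |t| * ∑ l, |b j l| < |S|) (j : ι) :
    g j = 0 := by
  obtain ⟨m, -, hm⟩ := Finset.exists_max_image Finset.univ (fun j => |g j|) ⟨j, Finset.mem_univ j⟩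
  have h1 : |S| * |g m| ≤ |t| * (∑ l, |b m l|) * |g m| := by
    rw [← abs_mul, h m, abs_mul, mul_assoc, Finset.sum_mul]
    refine mul_le_mul_of_nonneg_left ((Finset.abs_sum_le_sum_abs _ _).trans
      (Finset.sum_le_sum fun l _ => ?_)) (abs_nonneg t)
    rw [abs_mul]
    exact mul_le_mul_of_nonneg_left (hm l (Finset.mem_univ l)) (abs_nonneg _)
  have h2 : |g m| = 0 := by
    by_contra h0
    have hpos : 0 < |g m| := lt_of_le_of_ne (abs_nonneg _) (Ne.symm h0)
    exact absurd h1 (not_le.2 (mul_lt_mul_of_pos_right (hlt m) hpos))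
  exact abs_eq_zero.1 (le_antisymm (h2 ▸ hm j (Finset.mem_univ j)) (abs_nonneg _))

/-- A point of `X` whose local ring is a valuation ring is not isolated. -/
theorem IsValuativeAt.nhdsNE_neBot [IsDomain (Pol X)] (hX : IsAlgebraicSet X)
    (hfield : ¬ IsField (Pol X)) {x : X} (hx : IsValuativeAt x) : (𝓝[≠] x).NeBot := by
  classical
  let T : Fin n → MvPolynomial (Fin n) ℝ := fun i => MvPolynomial.X i - C (x.1 i)
  have hTeval : ∀ i (y : Fin n → ℝ), eval y (T i) = y i - x.1 i := fun i y => by simp [T]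
  obtain ⟨i₀, hi₀⟩ := exists_coord_ne_zero hfield x
  -- `T k` is a local uniformizer: it divides every translated coordinate in the local ring at `x`.
  obtain ⟨k, -, hk⟩ := hx.exists_dvd Finset.univ ⟨i₀, Finset.mem_univ i₀⟩
    (fun i => Pol.restrict X (T i))
  choose u c hu huc using fun i => hk i (Finset.mem_univ i)
  choose s hs using fun i => Pol.restrict_surjective X (u i)
  choose a ha using fun i => Pol.restrict_surjective X (c i)
  have hs0 : ∀ i, eval x.1 (s i) ≠ 0 := fun i => by
    rw [← Pol.restrict_apply, hs]; exact hu i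
  have hu0 : ∀ i, u i ≠ 0 := fun i h => hu i (by simp [h])
  have hTk : Pol.restrict X (T k) ≠ 0 := fun h => by
    have := huc i₀
    rw [h, mul_zero] at this
    exact (mul_ne_zero (hu0 i₀) hi₀) this
  -- These `n - 1` equations hold on `X`. It remains to see that, near `x`, their real solutions
  -- conversely lie in `X`.
  set F : {i // i ≠ k} → MvPolynomial (Fin n) ℝ := fun i => s i * T i - a i * T k with hF
  have hFI : Ideal.span (Set.range F) ≤ RingHom.ker (Pol.restrict X) := by
    rw [Ideal.span_le]
    rintro _ ⟨i, rfl⟩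
    simp only [SetLike.mem_coe, RingHom.mem_ker, hF, map_sub, map_mul, hs, ha]
    rw [sub_eq_zero]; exact huc i
  set S : MvPolynomial (Fin n) ℝ := ∏ i, s i with hS
  have hS0 : eval x.1 S ≠ 0 := by
    rw [hS, map_prod]; exact Finset.prod_ne_zero_iff.2 fun i _ => hs0 i
  have hST : ∀ i, S * T i ∈ Ideal.span (Set.range F) ⊔ Ideal.span {T k} := by
    intro i
    by_cases hi : i = k
    · subst hi
      exact Ideal.mul_mem_left _ _ (Ideal.mem_sup_right (Ideal.mem_span_singleton_self _))
    · have h1 : F ⟨i, hi⟩ + a i * T k ∈ Ideal.span (Set.range F) ⊔ Ideal.span {T k} :=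
        Ideal.add_mem _ (Ideal.mem_sup_left (Ideal.subset_span ⟨_, rfl⟩))
          (Ideal.mul_mem_left _ _ (Ideal.mem_sup_right (Ideal.mem_span_singleton_self _)))
      have h2 : S * T i = (∏ j ∈ Finset.univ.erase i, s j) * (F ⟨i, hi⟩ + a i * T k) := by
        rw [hS, ← Finset.mul_prod_erase _ _ (Finset.mem_univ i)]
        simp only [hF]; ring
      rw [h2]
      exact Ideal.mul_mem_left _ _ h1
  obtain ⟨r, γ, hγ⟩ := Submodule.fg_iff_exists_fin_generating_family.1
    ((isNoetherianRing_iff_ideal_fg (MvPolynomial (Fin n) ℝ)).1 inferInstance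
      (RingHom.ker (Pol.restrict X)))
  have hγI : ∀ j, Pol.restrict X (γ j) = 0 := fun j =>
    (RingHom.mem_ker (f := Pol.restrict X)).1 (hγ ▸ Submodule.subset_span ⟨j, rfl⟩)
  -- An explicit Nakayama argument: after multiplication by `S`, the ideal of `X` is contained in
  -- `(F)` plus `T k` times itself.
  have hrel : ∀ j, ∃ b : Fin r → MvPolynomial (Fin n) ℝ,
      S * γ j - T k * ∑ l, b l * γ l ∈ Ideal.span (Set.range F) := by
    intro j
    have h1 : γ j ∈ Ideal.span (Set.range T) := by
      have h := sub_eval_mem_span x.1 (γ j)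
      rwa [← Pol.restrict_apply, hγI j, map_zero, Pi.zero_apply, map_zero, sub_zero] at h
    obtain ⟨d, hd⟩ := Ideal.mem_span_range_iff_exists_fun.1 h1
    have h2 : S * γ j ∈ Ideal.span (Set.range F) ⊔ Ideal.span {T k} := by
      rw [← hd, Finset.mul_sum]
      refine Ideal.sum_mem _ fun i _ => ?_
      rw [mul_left_comm]
      exact Ideal.mul_mem_left _ _ (hST i)
    obtain ⟨f, hf, g, hg, hfg⟩ := Submodule.mem_sup.1 h2
    obtain ⟨h, rfl⟩ := Ideal.mem_span_singleton'.1 hg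
    -- On `X` the product `h * T k` vanishes and `T k` does not, so the cofactor `h` is again in the
    -- ideal of `X`.
    have h3 : Pol.restrict X h = 0 := by
      have := congrArg (Pol.restrict X) hfg
      rw [map_add, map_mul, map_mul, hγI j, mul_zero,
        (RingHom.mem_ker (f := Pol.restrict X)).1 (hFI hf), zero_add] at this
      exact (mul_eq_zero.1 this).resolve_right hTk
    have h4 : h ∈ Ideal.span (Set.range γ) := by
      change h ∈ Submodule.span _ (Set.range γ)
      rw [hγ]; exact h3
    obtain ⟨b, hb⟩ := Ideal.mem_span_range_iff_exists_fun.1 h4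
    refine ⟨b, ?_⟩
    rw [hb, ← hfg]
    convert hf using 1
    ring
  choose b hb using hrel
  rw [nhdsWithin_neBot]
  intro V hV
  obtain ⟨U, hU, hUV⟩ := mem_nhds_subtype X x V |>.1 hV
  -- At `x` the left side is `0` and `S` is nonzero. Near `x`, the relations `hrel` then force all
  -- `γ j` to vanish at a common zero of `F`.
  have hsmall : ∀ᶠ y in 𝓝 x.1, ∀ j, |eval y (T k)| * ∑ l, |eval y (b j l)| < |eval y S| := by
    refine eventually_all.2 fun j => ?_
    have hc1 : Continuous fun y : Fin n → ℝ => |eval y (T k)| * ∑ l, |eval y (b j l)| :=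
      (MvPolynomial.continuous_eval _).abs.mul
        (continuous_finsetSum _ fun l _ => (MvPolynomial.continuous_eval _).abs)
    have hc2 : Continuous fun y : Fin n → ℝ => |eval y S| := (MvPolynomial.continuous_eval _).abs
    refine hc1.continuousAt.eventually_lt hc2.continuousAt ?_
    rw [hTeval]
    simpa using hS0
  obtain ⟨y, ⟨hyU, hysmall⟩, hyk, hy⟩ := exists_solution_near x.1 k s a hs0
    (inter_mem hU hsmall)
  have hyF : Ideal.span (Set.range F) ≤ RingHom.ker (eval y) := by
    rw [Ideal.span_le]
    rintro _ ⟨i, rfl⟩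
    simp only [SetLike.mem_coe, RingHom.mem_ker, hF, map_sub, map_mul, hTeval]
    rw [sub_eq_zero]; exact hy i i.2
  have hγy : ∀ j, eval y (γ j) = 0 := by
    refine eq_zero_of_mul_eq_sum (S := eval y S) (t := eval y (T k))
      (b := fun j l => eval y (b j l)) (fun j => ?_) hysmall
    have := (RingHom.mem_ker (f := eval y)).1 (hyF (hb j))
    rw [map_sub, map_mul, map_mul, map_sum, sub_eq_zero] at this
    simpa only [map_mul] using this
  have hker : RingHom.ker (Pol.restrict X) ≤ RingHom.ker (eval y) := by
    rw [← hγ]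
    refine Ideal.span_le.2 ?_
    rintro _ ⟨j, rfl⟩
    exact hγy j
  have hyX : y ∈ X := hX.mem_of_forall fun G hG => hker hG
  exact ⟨⟨y, hyX⟩, hUV hyU, fun h => hyk (by rw [← (h : (⟨y, hyX⟩ : X) = x)])⟩

end Nonisolated

/-! ### The normalization: Dedekind property and conductor -/

section Normalization

variable {n m : ℕ} {X : Set (Fin n → ℝ)} {X' : Set (Fin m → ℝ)} {π : X' → X}

theorem IsPolynomialMap.continuous (hπ : IsPolynomialMap π) : Continuous π := by
  refine Continuous.subtype_mk (f := fun y => (π y).1) (continuous_pi fun i => ?_) _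
  obtain ⟨g, hg⟩ := hπ i
  exact g.continuous.congr fun y => (hg y).symm

theorem IsPolynomialMap.exists_pullback (hπ : IsPolynomialMap π) (f : Pol X) :
    ∃ g : Pol X', ∀ y, g y = f (π y) := by
  choose g hg using hπ
  choose G hG using fun i => Pol.restrict_surjective X' (g i)
  obtain ⟨F, rfl⟩ := Pol.restrict_surjective X f
  refine ⟨Pol.restrict X' (bind₁ G F), fun y => ?_⟩
  rw [Pol.restrict_apply, Pol.restrict_apply, ← aeval_eq_eval, ← aeval_eq_eval]
  rw [aeval_bind₁]
  congr 2
  funext i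
  rw [hg, ← hG, Pol.restrict_apply, aeval_eq_eval]

/-- The pullback of polynomial functions along a polynomial map. -/
noncomputable def IsPolynomialMap.pullback (hπ : IsPolynomialMap π) : Pol X →ₐ[ℝ] Pol X' where
  toFun f := (hπ.exists_pullback f).choose
  map_one' := Pol.ext fun y => by rw [(hπ.exists_pullback _).choose_spec]; simp
  map_mul' a b := Pol.ext fun y => by
    rw [(hπ.exists_pullback _).choose_spec, map_mul, map_mul, Pi.mul_apply, Pi.mul_apply,
      (hπ.exists_pullback a).choose_spec, (hπ.exists_pullback b).choose_spec]
  map_zero' := Pol.ext fun y => by rw [(hπ.exists_pullback _).choose_spec]; simp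
  map_add' a b := Pol.ext fun y => by
    rw [(hπ.exists_pullback _).choose_spec, map_add, map_add, Pi.add_apply, Pi.add_apply,
      (hπ.exists_pullback a).choose_spec, (hπ.exists_pullback b).choose_spec]
  commutes' r := Pol.ext fun y => by rw [(hπ.exists_pullback _).choose_spec]; simp

@[simp]
theorem IsPolynomialMap.pullback_apply (hπ : IsPolynomialMap π) (f : Pol X) (y : X') :
    hπ.pullback f y = f (π y) :=
  (hπ.exists_pullback f).choose_spec y

theorem isDomain_of_ratFunEquiv [IsDomain (Pol X)] (e : RatFun X ≃ₐ[ℝ] RatFun X') :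
    IsDomain (Pol X') := by
  have h1 : IsDomain (RatFun X) := IsFractionRing.isDomain (Pol X)
  have h2 : IsDomain (RatFun X') := e.symm.toMulEquiv.isDomain (RatFun X)
  exact (IsFractionRing.injective (Pol X') (RatFun X')).isDomain _

namespace IsNormalizationMap

variable {e : RatFun X ≃ₐ[ℝ] RatFun X'} (hπ : IsNormalizationMap π e)

/-- The inclusion of `Pol(X)` in its integral closure `Pol(X')`. -/
noncomputable abbrev pullback : Pol X →ₐ[ℝ] Pol X' :=
  hπ.isPolynomialMap.pullback

theorem map_algebraMap_eq (f : Pol X) :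
    e (algebraMap (Pol X) (RatFun X) f) = algebraMap (Pol X') (RatFun X') (hπ.pullback f) :=
  hπ.map_algebraMap f _ fun y => hπ.isPolynomialMap.pullback_apply f y

theorem pullback_injective : Function.Injective hπ.pullback := by
  intro a b h
  apply IsFractionRing.injective (Pol X) (RatFun X)
  apply e.injective
  rw [hπ.map_algebraMap_eq, hπ.map_algebraMap_eq, h]

/-- An element of `K(X)` is integral over `Pol(X)` iff its image in `K(X')` is so. -/
theorem isIntegralElem_iff (h : RatFun X) :
    ((algebraMap (Pol X') (RatFun X')).comp hπ.pullback.toRingHom).IsIntegralElem (e h) ↔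
      IsIntegral (Pol X) h := by
  have hcomp : (algebraMap (Pol X') (RatFun X')).comp hπ.pullback.toRingHom =
      (e : RatFun X →+* RatFun X').comp (algebraMap (Pol X) (RatFun X)) :=
    RingHom.ext fun f => (hπ.map_algebraMap_eq f).symm
  refine exists_congr fun P => and_congr_right fun _ => ?_
  rw [hcomp]
  change Polynomial.eval₂ _ ((e : RatFun X →+* RatFun X') h) P = 0 ↔ _
  rw [← Polynomial.hom_eval₂]
  exact map_eq_zero_iff e e.injective

theorem pullback_isIntegral : hπ.pullback.toRingHom.IsIntegral := by
  intro a
  have h1 : IsIntegral (Pol X) (e.symm (algebraMap (Pol X') (RatFun X') a)) :=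
    (hπ.isIntegral_iff _).2 ⟨a, by simp⟩
  rw [← hπ.isIntegralElem_iff, AlgEquiv.apply_symm_apply] at h1
  obtain ⟨P, hP, h⟩ := h1
  refine ⟨P, hP, ?_⟩
  rw [← Polynomial.hom_eval₂] at h
  exact (map_eq_zero_iff _ (IsFractionRing.injective (Pol X') (RatFun X'))).1 h

include hπ in
theorem isIntegrallyClosed [IsDomain (Pol X)] : IsIntegrallyClosed (Pol X') := by
  rw [isIntegrallyClosed_iff (RatFun X')]
  intro h hh
  let := hπ.pullback.toRingHom.toAlgebra
  let : Algebra (Pol X) (RatFun X') :=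
    ((algebraMap (Pol X') (RatFun X')).comp hπ.pullback.toRingHom).toAlgebra
  have : IsScalarTower (Pol X) (Pol X') (RatFun X') := IsScalarTower.of_algebraMap_eq fun _ => rfl
  have : Algebra.IsIntegral (Pol X) (Pol X') := ⟨hπ.pullback_isIntegral⟩
  have h1 : IsIntegral (Pol X) h := isIntegral_trans (A := Pol X') h hh
  have h2 : IsIntegral (Pol X) (e.symm h) := by
    rw [← hπ.isIntegralElem_iff, AlgEquiv.apply_symm_apply]; exact h1
  obtain ⟨g, hg⟩ := (hπ.isIntegral_iff _).1 h2
  exact ⟨g, by simpa using hg⟩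

include hπ in
theorem dimensionLEOne [IsDomain (Pol X)] [Ring.DimensionLEOne (Pol X)] :
    Ring.DimensionLEOne (Pol X') := by
  have := isDomain_of_ratFunEquiv e
  let := hπ.pullback.toRingHom.toAlgebra
  have : Algebra.IsIntegral (Pol X) (Pol X') := ⟨hπ.pullback_isIntegral⟩
  exact Ring.DimensionLEOne.of_isIntegral (Pol X) (Pol X')

include hπ in
theorem not_isField [IsDomain (Pol X)] (h : ¬ IsField (Pol X)) : ¬ IsField (Pol X') := by
  have := isDomain_of_ratFunEquiv e
  let := hπ.pullback.toRingHom.toAlgebra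
  have : Algebra.IsIntegral (Pol X) (Pol X') := ⟨hπ.pullback_isIntegral⟩
  exact fun h' => h (isField_of_isIntegral_of_isField hπ.pullback_injective h')

include hπ in
theorem isDedekindDomain [IsDomain (Pol X)] [Ring.DimensionLEOne (Pol X)] :
    IsDedekindDomain (Pol X') := by
  have := isDomain_of_ratFunEquiv e
  have := hπ.isIntegrallyClosed
  have := hπ.dimensionLEOne
  exact { (inferInstance : IsDomain (Pol X')), (inferInstance : IsNoetherianRing (Pol X')),
    (inferInstance : Ring.DimensionLEOne (Pol X')),
    (inferInstance : IsIntegrallyClosed (Pol X')) with }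

include hπ in
-- A Dedekind domain localized at a nonzero prime is a discrete valuation ring. The ideal of `y` is
-- nonzero because some translated coordinate is nonzero on `X'`.
theorem isValuativeAt [IsDomain (Pol X)] [Ring.DimensionLEOne (Pol X)] (h : ¬ IsField (Pol X))
    (y : X') : IsValuativeAt y := by
  have := isDomain_of_ratFunEquiv e
  have := hπ.isDedekindDomain
  have hne : idealAt y ≠ ⊥ := by
    obtain ⟨i, hi⟩ := exists_coord_ne_zero (hπ.not_isField h) y
    refine fun h0 => hi (Ideal.mem_bot.1 (h0 ▸ mem_idealAt.2 ?_))
    rw [Pol.restrict_apply]; simp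
  have : IsDiscreteValuationRing (Localization.AtPrime (idealAt y)) :=
    IsLocalization.AtPrime.isDiscreteValuationRing_of_dedekind_domain _ hne _
  exact isValuativeAt_of_valuationRing y

/-- The conductor of `Pol(X)` in its integral closure is nonzero. -/
theorem exists_conductor [IsDomain (Pol X)] : ∃ d : Pol X, d ≠ 0 ∧
    ∀ b : Pol X', ∃ a : Pol X, hπ.pullback a = hπ.pullback d * b := by
  classical
  let := hπ.pullback.toRingHom.toAlgebra
  have : IsScalarTower ℝ (Pol X) (Pol X') :=
    IsScalarTower.of_algebraMap_eq fun r => (hπ.pullback.commutes r).symm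
  have : Algebra.IsIntegral (Pol X) (Pol X') := ⟨hπ.pullback_isIntegral⟩
  have : Algebra.FiniteType (Pol X) (Pol X') :=
    Algebra.FiniteType.of_restrictScalars_finiteType ℝ (Pol X) (Pol X')
  have : Module.Finite (Pol X) (Pol X') := Algebra.IsIntegral.finite
  obtain ⟨t, ht⟩ := (Module.finite_def (R := Pol X) (M := Pol X')).1 inferInstance
  -- `Pol X'` is integral and of finite type over `Pol X`, hence a finite module; `d` is a common
  -- denominator of its generators.
  obtain ⟨⟨d, hd⟩, hdt⟩ := IsLocalization.exist_integer_multiples_of_finset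
    (nonZeroDivisors (Pol X)) (t.image fun b => e.symm (algebraMap (Pol X') (RatFun X') b))
  refine ⟨d, nonZeroDivisors.ne_zero hd, fun b => ?_⟩
  have hb : b ∈ Submodule.span (Pol X) (t : Set (Pol X')) := ht ▸ Submodule.mem_top
  induction hb using Submodule.span_induction with
  | mem b hb =>
    obtain ⟨a, ha⟩ := hdt _ (Finset.mem_image_of_mem _ hb)
    refine ⟨a, IsFractionRing.injective (Pol X') (RatFun X') ?_⟩
    rw [map_mul, ← hπ.map_algebraMap_eq, ← hπ.map_algebraMap_eq, ha, Algebra.smul_def, map_mul,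
      AlgEquiv.apply_symm_apply]
  | zero => exact ⟨0, by simp⟩
  | add b c _ _ hb hc =>
    obtain ⟨a, ha⟩ := hb
    obtain ⟨a', ha'⟩ := hc
    exact ⟨a + a', by rw [map_add, ha, ha', mul_add]⟩
  | smul r b _ hb =>
    obtain ⟨a, ha⟩ := hb
    refine ⟨r * a, ?_⟩
    rw [map_mul, ha, Algebra.smul_def]
    change _ = _ * (hπ.pullback r * b)
    ring

variable {d : Pol X}
  (hd : ∀ b : Pol X', ∃ a : Pol X, hπ.pullback a = hπ.pullback d * b)

include hd in
/-- Off the zeros of the conductor, `π` is surjective. -/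
theorem exists_eq_of_conductor [IsDomain (Pol X)] (hX' : IsAlgebraicSet X') {z : X}
    (hz : d z ≠ 0) : ∃ y : X', π y = z := by
  choose c hc using hd
  have hadd : ∀ a b, c (a + b) = c a + c b := fun a b =>
    hπ.pullback_injective (by rw [map_add, hc, hc, hc]; ring)
  have hmul : ∀ a b, d * c (a * b) = c a * c b := fun a b =>
    hπ.pullback_injective (by rw [map_mul, map_mul, hc, hc, hc]; ring)
  have hpb : ∀ a, c (hπ.pullback a) = d * a := fun a =>
    hπ.pullback_injective (by rw [hc, map_mul])
  -- Since `c b` is `d * b` seen in `Pol X`, evaluation at `z` extends to `Pol X'` by `b ↦ (d *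
  -- b)(z) / d(z)`. The extension is real-valued, so it comes from a real point of `X'`.
  let ψ : Pol X' →ₐ[ℝ] ℝ :=
    { toFun := fun b => c b z / d z
      map_one' := by
        have := hpb 1
        rw [map_one, mul_one] at this
        rw [this, div_self hz]
      map_mul' := fun a b => by
        have := congrArg (evalAt z) (hmul a b)
        simp only [map_mul, evalAt_apply] at this
        field_simp
        linarith
      map_zero' := by
        have := hpb 0
        rw [map_zero, mul_zero] at this
        rw [this]; simp
      map_add' := fun a b => by rw [hadd, map_add, Pi.add_apply, add_div]
      commutes' := fun r => by
        have := hpb (algebraMap ℝ (Pol X) r)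
        rw [AlgHom.commutes] at this
        change c (algebraMap ℝ (Pol X') r) z / d z = r
        rw [this]
        simp [hz] }
  obtain ⟨y, hy⟩ := hX'.exists_eq_evalAt ψ
  refine ⟨y, Subtype.ext (funext fun i => ?_)⟩
  have h1 := DFunLike.congr_fun hy (hπ.pullback (Pol.restrict X (MvPolynomial.X i)))
  rw [evalAt_apply, hπ.isPolynomialMap.pullback_apply, Pol.restrict_apply, eval_X] at h1
  rw [← h1]
  change c _ z / d z = _
  rw [hpb, map_mul, Pi.mul_apply, mul_div_cancel_left₀ _ hz, Pol.restrict_apply, eval_X]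

include hπ hd in
/-- Off the zeros of the conductor, the points of `X` are non-singular. -/
theorem isNonsingularPoint_of_conductor [IsDomain (Pol X)] [Ring.DimensionLEOne (Pol X)]
    (h : ¬ IsField (Pol X)) (y : X') (hy : d (π y) ≠ 0) : IsNonsingularPoint (π y) := by
  have hval : IsValuativeAt (π y) := by
    -- Multiplying `s` and `c` by `d` brings a divisibility relation down to `Pol X`; `d (π y) ≠ 0`
    -- keeps the new `s` nonzero at `π y`.
    have key : ∀ a b : Pol X, ∀ s c : Pol X', s y ≠ 0 →
        s * hπ.pullback a = c * hπ.pullback b → ∃ s c : Pol X, s (π y) ≠ 0 ∧ s * a = c * b := by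
      intro a b s c hs hsc
      obtain ⟨s', hs'⟩ := hd s
      obtain ⟨c', hc'⟩ := hd c
      refine ⟨s', c', ?_, hπ.pullback_injective ?_⟩
      · rw [← hπ.isPolynomialMap.pullback_apply, hs', map_mul, Pi.mul_apply,
          hπ.isPolynomialMap.pullback_apply]
        exact mul_ne_zero hy hs
      · rw [map_mul, map_mul, hs', hc']
        linear_combination hπ.pullback d * hsc
    intro a b
    obtain ⟨s, c, hs, h1 | h1⟩ := hπ.isValuativeAt h y (hπ.pullback a) (hπ.pullback b)
    · obtain ⟨s, c, hs, h1⟩ := key a b s c hs h1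
      exact ⟨s, c, hs, Or.inl h1⟩
    · obtain ⟨s, c, hs, h1⟩ := key b a s c hs h1
      exact ⟨s, c, hs, Or.inr h1⟩
  exact hval.isNonsingularPoint

end IsNormalizationMap

end Normalization

/-! ### Continuous rational functions and the local rings of the normalization -/

section ContinuousRational

variable {n m : ℕ} {X : Set (Fin n → ℝ)} {X' : Set (Fin m → ℝ)} {π : X' → X}

/-- The local ring of `X` at `x`, as a subring of the ring of rational functions. -/
def localSubring (x : X) : Subring (RatFun X) where
  carrier := {h | ∃ p q : Pol X, q x ≠ 0 ∧
    h * algebraMap (Pol X) (RatFun X) q = algebraMap (Pol X) (RatFun X) p}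
  mul_mem' := by
    rintro a b ⟨p, q, hq, h⟩ ⟨p', q', hq', h'⟩
    refine ⟨p * p', q * q', by simp [hq, hq'], ?_⟩
    rw [map_mul, map_mul, ← h, ← h']; ring
  one_mem' := ⟨1, 1, by simp, by simp⟩
  add_mem' := by
    rintro a b ⟨p, q, hq, h⟩ ⟨p', q', hq', h'⟩
    refine ⟨p * q' + p' * q, q * q', by simp [hq, hq'], ?_⟩
    rw [map_add, map_mul, map_mul, map_mul, ← h, ← h']; ring
  zero_mem' := ⟨0, 1, by simp, by simp⟩
  neg_mem' := by
    rintro a ⟨p, q, hq, h⟩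
    exact ⟨-p, q, hq, by rw [map_neg, neg_mul, h]⟩

/-- Either a rational function lies in the local ring at `x`, or it is the inverse of an element of
the maximal ideal. -/
theorem IsValuativeAt.mem_localSubring_or [IsDomain (Pol X)] {x : X} (hx : IsValuativeAt x)
    (h : RatFun X) : h ∈ localSubring x ∨ ∃ s c : Pol X, s x ≠ 0 ∧ c x = 0 ∧
      h * algebraMap (Pol X) (RatFun X) c = algebraMap (Pol X) (RatFun X) s := by
  obtain ⟨⟨b, a, ha⟩, hab⟩ := IsLocalization.surj (nonZeroDivisors (Pol X)) h
  simp only at hab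
  have ha' := (IsLocalization.map_units (RatFun X) (⟨a, ha⟩ : nonZeroDivisors (Pol X)))
  obtain ⟨s, c, hs, h1 | h1⟩ := hx a b
  · have h2 : h * algebraMap (Pol X) (RatFun X) c = algebraMap (Pol X) (RatFun X) s := by
      apply ha'.mul_right_cancel
      have := congrArg (algebraMap (Pol X) (RatFun X)) h1
      rw [map_mul, map_mul, ← hab] at this
      simp only
      rw [this]; ring
    by_cases hc : c x = 0
    · exact Or.inr ⟨s, c, hs, hc, h2⟩
    · exact Or.inl ⟨s, c, hc, h2⟩
  · refine Or.inl ⟨c, s, hs, ?_⟩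
    apply ha'.mul_right_cancel
    have := congrArg (algebraMap (Pol X) (RatFun X)) h1
    rw [map_mul, map_mul, ← hab] at this
    simp only
    rw [← this]; ring

/-- The local ring at a point is integrally closed if it is a valuation ring. -/
theorem IsValuativeAt.mem_localSubring_of_isIntegral [IsDomain (Pol X)] {x : X}
    (hx : IsValuativeAt x) {h : RatFun X} (hh : IsIntegral (localSubring x) h) :
    h ∈ localSubring x := by
  let _ : Field (RatFun X) := IsFractionRing.toField (Pol X)
  have hV : ∀ h : RatFun X, h ∈ localSubring x ∨ h⁻¹ ∈ localSubring x := by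
    intro h
    refine (hx.mem_localSubring_or h).imp_right ?_
    rintro ⟨s, c, hs, -, hsc⟩
    refine ⟨c, s, hs, ?_⟩
    rw [← hsc]
    have hs0 : algebraMap (Pol X) (RatFun X) s ≠ 0 := fun h0 => hs (by
      rw [(map_eq_zero_iff _ (IsFractionRing.injective (Pol X) (RatFun X))).1 h0]; simp)
    have h0 : h ≠ 0 := fun h0 => hs0 (by rw [← hsc, h0, zero_mul])
    rw [inv_mul_cancel_left₀ h0]
  let V : ValuationSubring (RatFun X) := ValuationSubring.ofSubring (localSubring x) hV
  have hh' : IsIntegral V h := hh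
  obtain ⟨v, hv⟩ := (IsIntegrallyClosed.isIntegral_iff (R := V) (K := RatFun X)).1 hh'
  rw [← hv]
  exact v.2

namespace IsNormalizationMap

variable {e : RatFun X ≃ₐ[ℝ] RatFun X'} (hπ : IsNormalizationMap π e)

include hπ in
/-- Continuous rational functions on the central locus lie in all local rings of the
normalization. -/
theorem mem_localSubring_of_mem_ContRat [IsDomain (Pol X)] [Ring.DimensionLEOne (Pol X)]
    (hf : ¬ IsField (Pol X)) (hX' : IsAlgebraicSet X') {h : RatFun X} (hh : h ∈ ContRat X)
    (y : X') : e h ∈ localSubring y := by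
  have := isDomain_of_ratFunEquiv e
  have := hπ.dimensionLEOne
  have hval := hπ.isValuativeAt hf y
  -- Otherwise `e h = s / c` has a pole at `y`.
  refine (hval.mem_localSubring_or (e h)).resolve_right ?_
  rintro ⟨s, c, hs, hc, hsc⟩
  obtain ⟨f, p, q, hq, hpq, hfpq⟩ := hh
  -- The Tietze extension makes `g ∘ π` continuous at `y` without having to know that `π y` is
  -- central.
  obtain ⟨g, hg⟩ := ContinuousMap.exists_restrict_eq (s := Cent X) isClosed_closure f
  obtain ⟨d, hd0, hd⟩ := hπ.exists_conductor
  have := hval.nhdsNE_neBot hX' (hπ.not_isField hf)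
  have hne : ∀ r : Pol X, r ≠ 0 → ∀ᶠ z in 𝓝[≠] y, r (π z) ≠ 0 := by
    intro r hr
    have hr' : hπ.pullback r ≠ 0 := fun h0 =>
      hr (hπ.pullback_injective (by rw [h0, map_zero]))
    have hfin := (Pol.finite_zeros hr').subset (Set.sdiff_subset (t := {y}))
    have h1 : ∀ᶠ z in 𝓝 y, z ∉ {z : X' | hπ.pullback r z = 0} \ {y} :=
      hfin.isClosed.isOpen_compl.mem_nhds fun h => h.2 rfl
    filter_upwards [h1.filter_mono nhdsWithin_le_nhds, self_mem_nhdsWithin] with z hz hzy h0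
    exact hz ⟨by simpa using h0, hzy⟩
  have hrel : c * hπ.pullback p = s * hπ.pullback q := by
    apply IsFractionRing.injective (Pol X') (RatFun X')
    have h1 := congrArg e hpq
    rw [map_mul, hπ.map_algebraMap_eq, hπ.map_algebraMap_eq] at h1
    rw [map_mul, map_mul, ← h1, ← hsc]; ring
  -- Off finitely many points, `π z` is non-singular, hence central, and there `g = p / q`. Letting
  -- `z` tend to the non-isolated point `y` gives `0 = s y`.
  have hev : (fun z : X' => c z * g (π z)) =ᶠ[𝓝[≠] y] fun z => s z := by
    filter_upwards [hne d hd0, hne q (nonZeroDivisors.ne_zero hq)] with z hdz hqz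
    have hz : π z ∈ Cent X := subset_closure (hπ.isNonsingularPoint_of_conductor hd hf z hdz)
    have h1 : g (π z) = p (π z) / q (π z) := by
      rw [← hfpq ⟨π z, hz⟩ hqz, ← hg]; rfl
    have h2 := congrArg (evalAt z) hrel
    simp only [map_mul, evalAt_apply, IsPolynomialMap.pullback_apply] at h2
    rw [h1, mul_div_assoc', div_eq_iff hqz, h2]
  have h1 : Tendsto (fun z : X' => c z * g (π z)) (𝓝[≠] y) (𝓝 (c y * g (π y))) :=
    ((c.continuous.mul (g.continuous.comp hπ.isPolynomialMap.continuous)).tendsto y).mono_left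
      nhdsWithin_le_nhds
  have h2 : Tendsto (fun z : X' => s z) (𝓝[≠] y) (𝓝 (s y)) :=
    (s.continuous.tendsto y).mono_left nhdsWithin_le_nhds
  have h3 := tendsto_nhds_unique_of_eventuallyEq h1 h2 hev
  rw [hc, zero_mul] at h3
  exact hs h3.symm

include hπ in
-- Regularity is tested in the local rings of `X'`; each is integrally closed and contains the image
-- of `ContRat X`.
theorem mem_Reg_of_isIntegral_ContRat [IsDomain (Pol X)] [Ring.DimensionLEOne (Pol X)]
    (hf : ¬ IsField (Pol X)) (hX' : IsAlgebraicSet X') {h : RatFun X}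
    (hh : IsIntegral (ContRat X) h) : e h ∈ Reg X' := by
  have := isDomain_of_ratFunEquiv e
  refine mem_Reg_of_forall fun y => ?_
  change e h ∈ localSubring y
  apply (hπ.isValuativeAt hf y).mem_localSubring_of_isIntegral
  let E : ContRat X →+* localSubring y :=
    ((e : RatFun X →+* RatFun X').comp (ContRat X).subtype).codRestrict (localSubring y)
      fun k => hπ.mem_localSubring_of_mem_ContRat hf hX' k.2 y
  exact hh.map_of_comp_eq E (e : RatFun X →+* RatFun X') rfl

include hπ in
/-- The normalization map is proper: points over a bounded set are bounded. -/
theorem exists_norm_le : ∃ B : X → ℝ, Continuous B ∧ ∀ y : X', ‖y.1‖ ≤ B (π y) := by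
  choose P hP hroot using fun i => hπ.pullback_isIntegral
    (Pol.restrict X' (MvPolynomial.X i : MvPolynomial (Fin m) ℝ))
  -- Each coordinate of `y` is a root of a monic polynomial with coefficients evaluated at `π y`, so
  -- Cauchy's root bound applies. Sums replace the maxima over coefficients and coordinates.
  refine ⟨fun z => ∑ i, (∑ j ∈ Finset.range (P i).natDegree, |(P i).coeff j z| + 1),
    continuous_finsetSum _ fun i _ => Continuous.add (continuous_finsetSum _ fun j _ =>
      ((P i).coeff j).continuous.abs) continuous_const, fun y => ?_⟩
  have hnonneg : ∀ i, 0 ≤ ∑ j ∈ Finset.range (P i).natDegree, |(P i).coeff j (π y)| + 1 :=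
    fun i => by positivity
  refine (pi_norm_le_iff_of_nonneg (Finset.sum_nonneg fun i _ => hnonneg i)).2 fun i => ?_
  refine le_trans ?_ (Finset.single_le_sum
    (f := fun i => ∑ j ∈ Finset.range (P i).natDegree, |(P i).coeff j (π y)| + 1)
    (fun i _ => hnonneg i) (Finset.mem_univ i))
  set Q := (P i).map (evalAt (π y) : Pol X →+* ℝ) with hQ
  have hQm : Q.Monic := (hP i).map _
  have hQr : Q.IsRoot (y.1 i) := by
    have h1 := congrArg (evalAt y : Pol X' →+* ℝ) (hroot i)
    rw [Polynomial.hom_eval₂, map_zero] at h1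
    rw [Polynomial.IsRoot, hQ, Polynomial.eval_map]
    convert h1 using 2
    · ext f
      exact (hπ.isPolynomialMap.pullback_apply f y).symm
    · change _ = Pol.restrict X' _ y
      rw [Pol.restrict_apply, eval_X]
  have hlt := hQr.norm_lt_cauchyBound hQm.ne_zero
  rw [Polynomial.cauchyBound, hQm.leadingCoeff, nnnorm_one, div_one, hQ,
    (hP i).natDegree_map] at hlt
  have hle := hlt.le.trans (add_le_add_left (Finset.sup_le fun j hj =>
    Finset.single_le_sum (f := fun j => ‖Q.coeff j‖₊) (fun _ _ => zero_le) hj) 1)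
  have := NNReal.coe_le_coe.2 hle
  simpa [hQ] using this

variable {d : Pol X}
  (hd : ∀ b : Pol X', ∃ a : Pol X, hπ.pullback a = hπ.pullback d * b)

include hd in
/-- A multiple by the conductor of a regular function on the normalization is a continuous rational
function on `X`. -/
theorem mul_mem_ContRat_of_conductor [IsDomain (Pol X)] (hd0 : d ≠ 0) (hX' : IsAlgebraicSet X')
    {k : RatFun X} (hk : e k ∈ Reg X') : algebraMap (Pol X) (RatFun X) d * k ∈ ContRat X := by
  obtain ⟨p, q, hq, hpq⟩ := hk
  obtain ⟨P, hP⟩ := hd p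
  obtain ⟨Q, hQ⟩ := hd q
  have hval : ∀ {a : Pol X} {b : Pol X'}, hπ.pullback a = hπ.pullback d * b →
      ∀ y, a (π y) = d (π y) * b y := by
    intro a b hab y
    have := congrArg (evalAt y) hab
    simpa only [map_mul, evalAt_apply, IsPolynomialMap.pullback_apply] using this
  have hfib : ∀ z, d z ≠ 0 → ∃ y, π y = z := fun z hz => hπ.exists_eq_of_conductor hd hX' hz
  -- `P` and `Q` are `d * p` and `d * q` seen in `Pol X`. Where `d` vanishes so may `Q`, but the
  -- factor `d` makes the value `0` whatever the quotient is.
  let f : X → ℝ := fun z => d z * (P z / Q z)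
  have hf : ∀ y, f (π y) = d (π y) * (p y / q y) := by
    intro y
    by_cases h0 : d (π y) = 0
    · simp [f, h0]
    · simp only [f, hval hP, hval hQ]
      rw [mul_div_mul_left _ _ h0]
  obtain ⟨B, hB, hBy⟩ := hπ.exists_norm_le
  have hcont : Continuous f := by
    refine continuous_iff_continuousAt.2 fun z => ?_
    by_cases hz : d z = 0
    -- By properness, the fibres over points near `z` lie in one compact set, on which `p / q` is
    -- bounded by some `M`. So `|f| ≤ |d| * M` near `z`, which tends to `0`.
    · have hcomp : IsCompact {y : X' | ‖y.1‖ ≤ B z + 1} := by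
        have := hX'.isClosed.isClosedEmbedding_subtypeVal.isCompact_preimage
          (isCompact_closedBall (0 : Fin m → ℝ) (B z + 1))
        convert this using 1
        ext y; simp
      obtain ⟨M, hM⟩ := hcomp.exists_bound_of_continuousOn (f := fun y => p y / q y)
        (p.continuous.div q.continuous hq).continuousOn
      have h1 : ∀ᶠ w in 𝓝 z, ‖f w‖ ≤ |d w| * M := by
        filter_upwards [hB.continuousAt.eventually_lt continuousAt_const (lt_add_one (B z))]
          with w hw
        by_cases hdw : d w = 0
        · simp [f, hdw]
        · obtain ⟨y, rfl⟩ := hfib w hdw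
          rw [hf, norm_mul]
          exact mul_le_mul_of_nonneg_left (hM y ((hBy y).trans hw.le)) (norm_nonneg _)
      have h2 : Tendsto (fun w => |d w| * M) (𝓝 z) (𝓝 0) := by
        have : Tendsto (fun w => |d w| * M) (𝓝 z) (𝓝 (|d z| * M)) :=
          (d.continuous.abs.mul (continuous_const (y := M))).tendsto z
        simpa [hz] using this
      have h3 : f z = 0 := by simp [f, hz]
      rw [ContinuousAt, h3]
      exact squeeze_zero_norm' h1 h2
    · have hQz : Q z ≠ 0 := by
        obtain ⟨y, rfl⟩ := hfib z hz
        rw [hval hQ]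
        exact mul_ne_zero hz (hq y)
      exact d.continuous.continuousAt.mul
        (P.continuous.continuousAt.div Q.continuous.continuousAt hQz)
  have hQ0 : Q ≠ 0 := by
    rintro rfl
    have := isDomain_of_ratFunEquiv e
    rw [map_zero] at hQ
    have hdπ : hπ.pullback d ≠ 0 := fun h0 => hd0 (hπ.pullback_injective (by rw [h0, map_zero]))
    have hq0 := (mul_eq_zero.1 hQ.symm).resolve_left hdπ
    -- A nowhere vanishing `q` can be zero only if `X'` is empty, and then `0 = 1` in `Pol X'`.
    exact zero_ne_one (α := Pol X') (Pol.ext fun y => (hq y (by simp [hq0])).elim)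
  refine ⟨⟨fun z => f z.1, hcont.comp continuous_subtype_val⟩, d * P, Q,
    mem_nonZeroDivisors_of_ne_zero hQ0, ?_, fun z hz => ?_⟩
  · apply e.injective
    rw [map_mul, map_mul, hπ.map_algebraMap_eq, hπ.map_algebraMap_eq, hπ.map_algebraMap_eq, hQ,
      map_mul, map_mul, hP, map_mul, map_mul, ← hpq]
    ring
  · simp only [ContinuousMap.coe_mk, f, map_mul, Pi.mul_apply, mul_div_assoc]

end IsNormalizationMap

end ContinuousRational

/-- The inverse of a unit that is integral over a field is integral. -/
theorem isIntegral_of_mul_eq_one {k A : Type*} [Field k] [CommRing A] [Algebra k A] {a b : A}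
    (ha : IsIntegral k a) (hab : a * b = 1) : IsIntegral k b := by
  -- The ring `k[a]` is Artinian and `a` is a non-zero-divisor in it, hence a unit there; so `b`
  -- lies in `k[a]`.
  have hfin : Module.Finite k (Algebra.adjoin k {a}) := Module.Finite.iff_fg.2 ha.fg_adjoin_singleton
  have hart : IsArtinianRing (Algebra.adjoin k {a}) := IsArtinianRing.of_finite k _
  have ha' : (⟨a, Algebra.self_mem_adjoin_singleton k a⟩ : Algebra.adjoin k {a}) ∈
      nonZeroDivisors (Algebra.adjoin k {a}) := by
    rw [mem_nonZeroDivisors_iff_right]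
    intro c hc
    have h1 : (c : A) * a = 0 := congrArg Subtype.val hc
    refine Subtype.ext ?_
    calc (c : A) = c * a * b := by rw [mul_assoc, hab, mul_one]
      _ = 0 := by rw [h1, zero_mul]
  obtain ⟨u, hu⟩ := IsArtinianRing.isUnit_of_mem_nonZeroDivisors ha'
  have h2 : a * ((u⁻¹ : (Algebra.adjoin k {a})ˣ) : Algebra.adjoin k {a}) = 1 := by
    have := congrArg Subtype.val (u.mul_inv)
    rwa [hu] at this
  have hb : b = ((u⁻¹ : (Algebra.adjoin k {a})ˣ) : Algebra.adjoin k {a}) := by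
    rw [← one_mul (((u⁻¹ : (Algebra.adjoin k {a})ˣ) : Algebra.adjoin k {a}) : A), ← hab,
      mul_comm a b, mul_assoc, h2, mul_one]
  rw [hb]
  exact (Algebra.IsIntegral.isIntegral (R := k)
    ((u⁻¹ : (Algebra.adjoin k {a})ˣ) : Algebra.adjoin k {a})).map (Algebra.adjoin k {a}).val

/-! ### Integrality of regular functions modulo the conductor -/

section Integrality

variable {n : ℕ} {X : Set (Fin n → ℝ)}

/-- The quotient of the coordinate ring of a curve by a nonzero element is finite-dimensional. -/
theorem Pol.finite_quotient [IsDomain (Pol X)] [Ring.DimensionLEOne (Pol X)] {d : Pol X}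
    (hd : d ≠ 0) : Module.Finite ℝ (Pol X ⧸ Ideal.span {d}) := by
  -- For a finitely generated algebra over a field, finiteness means Krull dimension at most zero.
  -- Primes of the quotient pull back to primes containing `d ≠ 0`, which are maximal.
  rw [Module.finite_iff_krullDimLE_zero]
  refine Ring.krullDimLE_zero_iff.2 fun P hP => ?_
  have h1 : (P.comap (Ideal.Quotient.mk (Ideal.span {d}))).IsMaximal := by
    refine Ring.DimensionLEOne.maximalOfPrime (fun h0 => hd ?_) inferInstance
    rw [← Ideal.mem_bot, ← h0, Ideal.mem_comap,
      Ideal.Quotient.eq_zero_iff_mem.2 (Ideal.mem_span_singleton_self d)]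
    exact P.zero_mem
  exact Ideal.isMaximal_of_isIntegral_of_isMaximal_comap' _
    (RingHom.isIntegral_of_surjective _ Ideal.Quotient.mk_surjective) P h1

/-- Modulo a nonzero element, regular functions on a curve are integral over `ℝ`. -/
theorem exists_monic_aeval_eq_mul [IsDomain (Pol X)] [Ring.DimensionLEOne (Pol X)] {d : Pol X}
    (hd : d ≠ 0) {k : RatFun X} (hk : k ∈ Reg X) :
    ∃ P : Polynomial ℝ, P.Monic ∧ P.natDegree ≠ 0 ∧ ∃ c ∈ Reg X,
      Polynomial.aeval k P = algebraMap (Pol X) (RatFun X) d * c := by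
  let ι : Pol X →ₐ[ℝ] Reg X := (IsScalarTower.toAlgHom ℝ (Pol X) (RatFun X)).codRestrict (Reg X)
    fun p => ⟨p, 1, fun x => by simp, by simp⟩
  let J : Ideal (Reg X) := Ideal.span {ι d}
  have := Pol.finite_quotient hd
  have hpol : ∀ p : Pol X, IsIntegral ℝ (Ideal.Quotient.mkₐ ℝ J (ι p)) := by
    intro p
    have h1 : IsIntegral ℝ (Ideal.Quotient.mkₐ ℝ (Ideal.span {d}) p) :=
      Algebra.IsIntegral.isIntegral _
    exact h1.map (Ideal.Quotient.liftₐ (Ideal.span {d}) ((Ideal.Quotient.mkₐ ℝ J).comp ι) (by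
      intro a ha
      obtain ⟨b, rfl⟩ := Ideal.mem_span_singleton'.1 ha
      rw [AlgHom.comp_apply, Ideal.Quotient.mkₐ_eq_mk, Ideal.Quotient.eq_zero_iff_mem, map_mul]
      exact J.mul_mem_left _ (Ideal.mem_span_singleton_self _)))
  -- With `k = p / q`, the classes of `p` and `q` are integral over `ℝ`, and so is the inverse of
  -- the unit `q`.
  have hint : IsIntegral ℝ (Ideal.Quotient.mkₐ ℝ J ⟨k, hk⟩) := by
    obtain ⟨p, q, hq, hpq⟩ := hk
    obtain ⟨r, hr⟩ : ∃ r : Reg X, ι q * r = 1 := by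
      have hqm : q ∈ nonZeroDivisors (Pol X) := by
        rw [mem_nonZeroDivisors_iff_right]
        intro c hc
        refine Pol.ext fun x => ?_
        have := congrArg (evalAt x) hc
        simp only [map_mul, evalAt_apply, map_zero, mul_eq_zero] at this
        simpa using this.resolve_right (hq x)
      obtain ⟨r, hr⟩ := (IsLocalization.map_units (RatFun X)
        (⟨q, hqm⟩ : nonZeroDivisors (Pol X))).exists_right_inv
      simp only at hr
      exact ⟨⟨r, 1, q, hq, by rw [mul_comm, hr, map_one]⟩, Subtype.ext hr⟩
    have hk' : (⟨k, p, q, hq, hpq⟩ : Reg X) = ι p * r := by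
      calc (⟨k, p, q, hq, hpq⟩ : Reg X) = ⟨k, p, q, hq, hpq⟩ * ι q * r := by
            rw [mul_assoc, hr, mul_one]
        _ = ι p * r := by
          congr 1
          exact Subtype.ext hpq
    rw [hk', map_mul]
    refine (hpol p).mul (isIntegral_of_mul_eq_one (hpol q) ?_)
    rw [← map_mul, hr, map_one]
  obtain ⟨P, hP, h0⟩ := hint
  rw [← Polynomial.aeval_def, Polynomial.aeval_algHom_apply, Ideal.Quotient.mkₐ_eq_mk,
    Ideal.Quotient.eq_zero_iff_mem] at h0
  obtain ⟨c, hc⟩ := Ideal.mem_span_singleton'.1 h0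
  -- The factor `Polynomial.X` ensures positive degree: `P` may be `1` when `d` is a unit in `Reg
  -- X`.
  refine ⟨P * Polynomial.X, hP.mul Polynomial.monic_X, by simp [hP.ne_zero], c * k,
    mul_mem c.2 hk, ?_⟩
  have h1 := congrArg (Reg X).val hc
  rw [← Polynomial.aeval_algHom_apply, map_mul, mul_comm] at h1
  change _ = Polynomial.aeval k P at h1
  rw [map_mul, Polynomial.aeval_X, ← mul_assoc]
  exact congrArg (· * k) h1.symm

end Integrality

/-- Integrality over the continuous rational functions of the regular functions on the
normalization. -/
theorem IsNormalizationMap.isIntegral_ContRat {n m : ℕ} {X : Set (Fin n → ℝ)}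
    {X' : Set (Fin m → ℝ)} {π : X' → X} {e : RatFun X ≃ₐ[ℝ] RatFun X'}
    (hπ : IsNormalizationMap π e) [IsDomain (Pol X)] [Ring.DimensionLEOne (Pol X)]
    (hX' : IsAlgebraicSet X') {k : RatFun X} (hk : e k ∈ Reg X') : IsIntegral (ContRat X) k := by
  have : IsDomain (RatFun X) := IsFractionRing.isDomain (Pol X)
  have := isDomain_of_ratFunEquiv e
  have := hπ.dimensionLEOne
  obtain ⟨d, hd0, hd⟩ := hπ.exists_conductor
  have hdπ : hπ.pullback d ≠ 0 := fun h0 => hd0 (hπ.pullback_injective (by rw [h0, map_zero]))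
  obtain ⟨P, hP, hdeg, c, hc, hPc⟩ := exists_monic_aeval_eq_mul hdπ hk
  have hmem : Polynomial.aeval k P ∈ ContRat X := by
    have h1 : Polynomial.aeval k P = algebraMap (Pol X) (RatFun X) d * e.symm c := by
      apply e.injective
      rw [map_mul, hπ.map_algebraMap_eq, AlgEquiv.apply_symm_apply, ← hPc]
      exact (Polynomial.aeval_algHom_apply (e : RatFun X →ₐ[ℝ] RatFun X') k P).symm
    rw [h1]
    exact hπ.mul_mem_ContRat_of_conductor hd hd0 hX' (by rwa [AlgEquiv.apply_symm_apply])
  -- `k` is a root of the monic polynomial `P - P(k)`, whose constant term lies in `ContRat X` by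
  -- `hmem`.
  refine IsIntegral.of_aeval_monic (hP.map (algebraMap ℝ (ContRat X))) ?_ ?_
  · rwa [hP.natDegree_map]
  · rw [Polynomial.aeval_map_algebraMap]
    exact isIntegral_algebraMap (R := ContRat X) (x := ⟨_, hmem⟩)

end RealAlgGeom

theorem mainTheorem6 {n m : ℕ} {X : Set (Fin n → ℝ)} {X' : Set (Fin m → ℝ)}
    (hX : RealAlgGeom.IsIrreducibleAlgebraicSet X) (hdim : RealAlgGeom.dim X = 1)
    (hX' : RealAlgGeom.IsAlgebraicSet X') (π : X' → X)
    (e : RealAlgGeom.RatFun X ≃ₐ[ℝ] RealAlgGeom.RatFun X')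
    (hπ : RealAlgGeom.IsNormalizationMap π e) :
    ((integralClosure (RealAlgGeom.ContRat X) (RealAlgGeom.RatFun X)).restrictScalars ℝ).map
      (e : RealAlgGeom.RatFun X →ₐ[ℝ] RealAlgGeom.RatFun X') = RealAlgGeom.Reg X' := by
  have hdom := hX.isDomain
  have hdim' : ringKrullDim (RealAlgGeom.Pol X) = 1 := hdim
  have hle : Ring.KrullDimLE 1 (RealAlgGeom.Pol X) :=
    Ring.krullDimLE_iff.2 (by rw [hdim']; rfl)
  have hone : Ring.DimensionLEOne (RealAlgGeom.Pol X) :=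
    ⟨fun h0 hP => Ring.krullDimLE_one_iff_of_noZeroDivisors.1 hle _ h0 hP⟩
  have hfield : ¬ IsField (RealAlgGeom.Pol X) := fun h => by
    rw [ringKrullDim_eq_zero_of_isField h] at hdim'
    exact zero_ne_one hdim'
  ext h
  rw [Subalgebra.mem_map]
  constructor
  · rintro ⟨k, hk, rfl⟩
    exact hπ.mem_Reg_of_isIntegral_ContRat hfield hX' hk
  · intro hh
    exact ⟨e.symm h, hπ.isIntegral_ContRat hX' (by rwa [AlgEquiv.apply_symm_apply]),
      e.apply_symm_apply h⟩
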